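/- Let $\mathcal C$ be a category with finite limits. **Definitions.** A *relation* $R$ on $\mathcal C$ assigns to each object $X$ a diagram $\eta_X\colon X\to\Psi X$, $\epsilon_{0X},\epsilon_{1X}\colon \Psi X\rightrightarrows X$ with $\epsilon_{0X}\eta_X=\epsilon_{1X}\eta_X=1_X$, and to each $f\colon X\to Y$ a morphism $Rf\colon\Psi X\to\Psi Y$ commuting with $\eta,\epsilon_0,\epsilon_1$ over $f$. A *factorization* $F$ on $\mathcal C$ assigns to each $f\colon X\to Y$ a factorization $X\xrightarrow{\lambda_f}\Phi f\xrightarrow{\rho_f}Y$ of $f$, and to each commutative square $\langle\alpha,\beta\rangle\colon f\to g$ a morphism $\Phi f\to\Phi g$ commuting with $\lambda,\rho$ over $\alpha,\beta$. Functoriality is not required; if identities and composition are preserved, the relation or factorization is called *functorial*. Morphisms of relations are families $\Psi X\to\Psi'X$ commuting with $\eta,\epsilon_0,\epsilon_1$, and morphisms of factorizations are families $\Phi f\to\Phi' f$ commuting with $\lambda,\rho$ (naturality is not required); this gives categories $\mathbf{Rel}[\mathcal C]$ and $\mathbf{Fact}[\mathcal C]$. Functorial relations (factorizations) and those morphisms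 that are natural form categories $\mathbf{FRel}[\mathcal C]$ and $\mathbf{FFact}[\mathcal C]$. The functor $\mathfrak M\colon\mathbf{Rel}[\mathcal C]\to\mathbf{Fact}[\mathcal C]$ sends $R$ to the factorization $$X\xrightarrow{(1,\eta f)}X\times_Y\Psi Y\xrightarrow{\epsilon_1\pi_{\Psi Y}}Y$$ of $f\colon X\to Y$, where $X\times_Y\Psi Y$ is the pullback of $f$ and $\epsilon_{0Y}$. The functor $\Xi\colon\mathbf{Fact}[\mathcal C]\to\mathbf{Rel}[\mathcal C]$ sends $F$ to the relation with $\Psi X=\Phi(\Delta_X)$, $\eta_X=\lambda_{\Delta_X}$ and $(\epsilon_{0X},\epsilon_{1X})=\rho_{\Delta_X}$, where $\Delta_X\colon X\to X\times X$ is the diagonal. In both cases the actions on morphisms are the evident ones, and $\mathfrak M$ and $\Xi$ restrict to functors between $\mathbf{FRel}[\mathcal C]$ and $\mathbf{FFact}[\mathcal C]$. For a factorization $F$ let $\mathrm{coalg}_F$ be the class of $f\colon X\to Y$ for which there is $s\colon Y\to\Phi f$ with $sf=\lambda_f$, $\rho_fs=1_Y$, and $\mathrm{alg}_F$ the class of those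 for which there is $s\colon\Phi f\to X$ with $s\lambda_f=1_X$, $fs=\rho_f$. $F$ is a *weak factorization structure* if $\lambda_f\in\mathrm{coalg}_F$ and $\rho_f\in\mathrm{alg}_F$ for all $f$. It is *type-theoretic* if moreover every morphism to a terminal object is in $\mathrm{alg}_F$ and $\mathrm{coalg}_F$ is stable under pullback along $\mathrm{alg}_F$. A relation $R$ is an *$\mathrm{Id}$-presentation* if $\mathfrak M R$ is a weak factorization structure and, for each object $X$, $(\epsilon_{0X},\epsilon_{1X})\colon\Psi X\to X\times X$ is in $\mathrm{alg}_{\mathfrak MR}$ and, for each $\alpha\colon A\to X$ and $i=0,1$, the morphism $(1_A,\eta_X\alpha)\colon A\to A\times_{X}\Psi X$ into the pullback of $\alpha$ and $\epsilon_{iX}$ has the left lifting property against $\mathrm{alg}_{\mathfrak MR}$. Let $\mathbf{IdPres}[\mathcal C]\subseteq\mathbf{Rel}[\mathcal C]$, $\mathbf{ttWFS}[\mathcal C]\subseteq\mathbf{Fact}[\mathcal C]$, $\mathbf{FIdPres}[\mathcal C]\subseteq\mathbf{FRel}[\mathcal C]$ and $\mathbf{FttWFS}[\mathcal C]\subseteq\mathbf{FFact}[\mathcal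 C]$ be the full subcategories of $\mathrm{Id}$-presentations and of type-theoretic weak factorization structures, respectively. For a category $\mathcal D$ let $|\mathcal D|$ be the preorder, viewed as a category, with the same objects and with $X\le Y$ if there is a morphism $X\to Y$ in $\mathcal D$. **Theorem.** The functors $\mathfrak M$ and $\Xi$ restrict to functors $$\mathfrak M\colon\mathbf{IdPres}[\mathcal C]\rightleftarrows\mathbf{ttWFS}[\mathcal C]:\Xi,\qquad \mathfrak M\colon\mathbf{FIdPres}[\mathcal C]\rightleftarrows\mathbf{FttWFS}[\mathcal C]:\Xi,$$ and these commute with the inclusions $\mathbf{FIdPres}[\mathcal C]\to\mathbf{IdPres}[\mathcal C]$ and $\mathbf{FttWFS}[\mathcal C]\to\mathbf{ttWFS}[\mathcal C]$. After proset truncation, $|\mathfrak M|$ and $|\Xi|$ constitute an equivalence $$|\mathbf{IdPres}[\mathcal C]|\simeq|\mathbf{ttWFS}[\mathcal C]|.$$ This equivalence restricts to an equivalence between the full subcategory of $|\mathbf{IdPres}[\mathcal C]|$ on the functorial $\mathrm{Id}$-presentations and the full subcategory of $|\mathbf{ttWFS}[\mathcal C]|$ on the functorial type-theoretic weak factorization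 structures, compatibly with the truncations of the functors $\mathfrak M\colon\mathbf{FIdPres}[\mathcal C]\rightleftarrows\mathbf{FttWFS}[\mathcal C]:\Xi$. -/

import Mathlib

open CategoryTheory CategoryTheory.Limits

universe v u

/-! ### Sections of the three restriction functors, in the afunctorial sense

All three kinds of objects below are sections in the category of categories and afunctors, that is,
assignments on objects and on morphisms without any compatibility with identities and composition.
Their morphisms are the unnatural transformations lying over the identity. -/

/-- A relation on `C`: to every object `X` it assigns a diagram
`η : X ⟶ Ψ X`, `ε₀, ε₁ : Ψ X ⟶ X` with `η ≫ ε₀ = η ≫ ε₁ = 𝟙 X`, and to every morphism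
`f : X ⟶ Y` a morphism of such diagrams which restricts to `f`. -/
structure Reln (C : Type u) [Category.{v} C] where
  Ψ : C → C
  η : ∀ X : C, X ⟶ Ψ X
  ε₀ : ∀ X : C, Ψ X ⟶ X
  ε₁ : ∀ X : C, Ψ X ⟶ X
  η_ε₀ : ∀ X : C, η X ≫ ε₀ X = 𝟙 X
  η_ε₁ : ∀ X : C, η X ≫ ε₁ X = 𝟙 X
  map : ∀ {X Y : C}, (X ⟶ Y) → (Ψ X ⟶ Ψ Y)
  η_map : ∀ {X Y : C} (f : X ⟶ Y), η X ≫ map f = f ≫ η Y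
  map_ε₀ : ∀ {X Y : C} (f : X ⟶ Y), map f ≫ ε₀ Y = ε₀ X ≫ f
  map_ε₁ : ∀ {X Y : C} (f : X ⟶ Y), map f ≫ ε₁ Y = ε₁ X ≫ f

/-- A relational factorization on `C`: to every morphism `f : X ⟶ Y` it assigns a diagram
`l : X ⟶ Φ f`, `κ : Φ f ⟶ X`, `r : Φ f ⟶ Y` with `l ≫ κ = 𝟙 X` and `l ≫ r = f`, and to every
commutative square `(α, β)` from `f` to `g` a morphism of such diagrams which restricts to the
square. -/
structure RelFactn (C : Type u) [Category.{v} C] where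
  Φ : ∀ {X Y : C}, (X ⟶ Y) → C
  l : ∀ {X Y : C} (f : X ⟶ Y), X ⟶ Φ f
  κ : ∀ {X Y : C} (f : X ⟶ Y), Φ f ⟶ X
  r : ∀ {X Y : C} (f : X ⟶ Y), Φ f ⟶ Y
  l_κ : ∀ {X Y : C} (f : X ⟶ Y), l f ≫ κ f = 𝟙 X
  l_r : ∀ {X Y : C} (f : X ⟶ Y), l f ≫ r f = f
  map : ∀ {X Y W Z : C} {f : X ⟶ Y} {g : W ⟶ Z} (α : X ⟶ W) (β : Y ⟶ Z),
    f ≫ β = α ≫ g → (Φ f ⟶ Φ g)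
  l_map : ∀ {X Y W Z : C} {f : X ⟶ Y} {g : W ⟶ Z} (α : X ⟶ W) (β : Y ⟶ Z)
    (w : f ≫ β = α ≫ g), l f ≫ map α β w = α ≫ l g
  map_κ : ∀ {X Y W Z : C} {f : X ⟶ Y} {g : W ⟶ Z} (α : X ⟶ W) (β : Y ⟶ Z)
    (w : f ≫ β = α ≫ g), map α β w ≫ κ g = κ f ≫ α
  map_r : ∀ {X Y W Z : C} {f : X ⟶ Y} {g : W ⟶ Z} (α : X ⟶ W) (β : Y ⟶ Z)
    (w : f ≫ β = α ≫ g), map α β w ≫ r g = r f ≫ β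

/-- A factorization on `C`: to every morphism `f : X ⟶ Y` it assigns a factorization
`l : X ⟶ Φ f`, `r : Φ f ⟶ Y` of `f`, and to every commutative square `(α, β)` from `f` to `g` a
morphism of factorizations which restricts to the square. -/
structure Factn (C : Type u) [Category.{v} C] where
  Φ : ∀ {X Y : C}, (X ⟶ Y) → C
  l : ∀ {X Y : C} (f : X ⟶ Y), X ⟶ Φ f
  r : ∀ {X Y : C} (f : X ⟶ Y), Φ f ⟶ Y
  l_r : ∀ {X Y : C} (f : X ⟶ Y), l f ≫ r f = f
  map : ∀ {X Y W Z : C} {f : X ⟶ Y} {g : W ⟶ Z} (α : X ⟶ W) (β : Y ⟶ Z),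
    f ≫ β = α ≫ g → (Φ f ⟶ Φ g)
  l_map : ∀ {X Y W Z : C} {f : X ⟶ Y} {g : W ⟶ Z} (α : X ⟶ W) (β : Y ⟶ Z)
    (w : f ≫ β = α ≫ g), l f ≫ map α β w = α ≫ l g
  map_r : ∀ {X Y W Z : C} {f : X ⟶ Y} {g : W ⟶ Z} (α : X ⟶ W) (β : Y ⟶ Z)
    (w : f ≫ β = α ≫ g), map α β w ≫ r g = r f ≫ β

section Categories

variable {C : Type u} [Category.{v} C]

/-- An unnatural transformation of relations, with identity components on each object `X`. -/
@[ext]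
structure Reln.Hom (R S : Reln C) where
  app : ∀ X : C, R.Ψ X ⟶ S.Ψ X
  η_app : ∀ X : C, R.η X ≫ app X = S.η X
  app_ε₀ : ∀ X : C, app X ≫ S.ε₀ X = R.ε₀ X
  app_ε₁ : ∀ X : C, app X ≫ S.ε₁ X = R.ε₁ X

instance : Category (Reln C) where
  Hom := Reln.Hom
  id R := ⟨fun _ => 𝟙 _, by simp, by simp, by simp⟩
  comp a b := ⟨fun X => a.app X ≫ b.app X,
    fun X => by rw [← Category.assoc, a.η_app, b.η_app],
    fun X => by rw [Category.assoc, b.app_ε₀, a.app_ε₀],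
    fun X => by rw [Category.assoc, b.app_ε₁, a.app_ε₁]⟩
  id_comp a := Reln.Hom.ext (funext fun _ => Category.id_comp _)
  comp_id a := Reln.Hom.ext (funext fun _ => Category.comp_id _)
  assoc a b c := Reln.Hom.ext (funext fun _ => Category.assoc _ _ _)

/-- An unnatural transformation of relational factorizations, with identity components on the
source and on the target of each morphism. -/
@[ext]
structure RelFactn.Hom (P Q : RelFactn C) where
  app : ∀ {X Y : C} (f : X ⟶ Y), P.Φ f ⟶ Q.Φ f
  l_app : ∀ {X Y : C} (f : X ⟶ Y), P.l f ≫ app f = Q.l f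
  app_κ : ∀ {X Y : C} (f : X ⟶ Y), app f ≫ Q.κ f = P.κ f
  app_r : ∀ {X Y : C} (f : X ⟶ Y), app f ≫ Q.r f = P.r f

instance : Category (RelFactn C) where
  Hom := RelFactn.Hom
  id P := ⟨fun _ => 𝟙 _, by simp, by simp, by simp⟩
  comp a b := ⟨fun f => a.app f ≫ b.app f,
    fun f => by rw [← Category.assoc, a.l_app, b.l_app],
    fun f => by rw [Category.assoc, b.app_κ, a.app_κ],
    fun f => by rw [Category.assoc, b.app_r, a.app_r]⟩
  id_comp a := RelFactn.Hom.ext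
    (funext fun _ => funext fun _ => funext fun _ => Category.id_comp _)
  comp_id a := RelFactn.Hom.ext
    (funext fun _ => funext fun _ => funext fun _ => Category.comp_id _)
  assoc a b c := RelFactn.Hom.ext
    (funext fun _ => funext fun _ => funext fun _ => Category.assoc _ _ _)

/-- An unnatural transformation of factorizations, with identity components on the
source and on the target of each morphism. -/
@[ext]
structure Factn.Hom (F G : Factn C) where
  app : ∀ {X Y : C} (f : X ⟶ Y), F.Φ f ⟶ G.Φ f
  l_app : ∀ {X Y : C} (f : X ⟶ Y), F.l f ≫ app f = G.l f
  app_r : ∀ {X Y : C} (f : X ⟶ Y), app f ≫ G.r f = F.r f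

instance : Category (Factn C) where
  Hom := Factn.Hom
  id F := ⟨fun _ => 𝟙 _, by simp, by simp⟩
  comp a b := ⟨fun f => a.app f ≫ b.app f,
    fun f => by rw [← Category.assoc, a.l_app, b.l_app],
    fun f => by rw [Category.assoc, b.app_r, a.app_r]⟩
  id_comp a := Factn.Hom.ext
    (funext fun _ => funext fun _ => funext fun _ => Category.id_comp _)
  comp_id a := Factn.Hom.ext
    (funext fun _ => funext fun _ => funext fun _ => Category.comp_id _)
  assoc a b c := Factn.Hom.ext
    (funext fun _ => funext fun _ => funext fun _ => Category.assoc _ _ _)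

/-! ### The functorial versions: genuine functors and natural transformations -/

/-- The assignment on morphisms preserves identities and composition. -/
structure Reln.IsFunctorial (R : Reln C) : Prop where
  map_id : ∀ X : C, R.map (𝟙 X) = 𝟙 (R.Ψ X)
  map_comp : ∀ {X Y Z : C} (f : X ⟶ Y) (g : Y ⟶ Z), R.map (f ≫ g) = R.map f ≫ R.map g

/-- The assignment on squares preserves identities and composition. -/
structure RelFactn.IsFunctorial (P : RelFactn C) : Prop where
  map_id : ∀ {X Y : C} (f : X ⟶ Y) (w : f ≫ 𝟙 Y = 𝟙 X ≫ f), P.map (𝟙 X) (𝟙 Y) w = 𝟙 (P.Φ f)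
  map_comp : ∀ {X Y X' Y' X'' Y'' : C} {f : X ⟶ Y} {f' : X' ⟶ Y'} {f'' : X'' ⟶ Y''}
    (α : X ⟶ X') (β : Y ⟶ Y') (α' : X' ⟶ X'') (β' : Y' ⟶ Y'')
    (w : f ≫ β = α ≫ f') (w' : f' ≫ β' = α' ≫ f'') (w'' : f ≫ β ≫ β' = (α ≫ α') ≫ f''),
    P.map (α ≫ α') (β ≫ β') w'' = P.map α β w ≫ P.map α' β' w'

/-- The assignment on squares preserves identities and composition. -/
structure Factn.IsFunctorial (F : Factn C) : Prop where
  map_id : ∀ {X Y : C} (f : X ⟶ Y) (w : f ≫ 𝟙 Y = 𝟙 X ≫ f), F.map (𝟙 X) (𝟙 Y) w = 𝟙 (F.Φ f)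
  map_comp : ∀ {X Y X' Y' X'' Y'' : C} {f : X ⟶ Y} {f' : X' ⟶ Y'} {f'' : X'' ⟶ Y''}
    (α : X ⟶ X') (β : Y ⟶ Y') (α' : X' ⟶ X'') (β' : Y' ⟶ Y'')
    (w : f ≫ β = α ≫ f') (w' : f' ≫ β' = α' ≫ f'') (w'' : f ≫ β ≫ β' = (α ≫ α') ≫ f''),
    F.map (α ≫ α') (β ≫ β') w'' = F.map α β w ≫ F.map α' β' w'

variable (C) in
/-- Functorial relations on `C`. -/
structure FReln where
  toReln : Reln C
  functorial : toReln.IsFunctorial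

variable (C) in
/-- Functorial relational factorizations on `C`. -/
structure FRelFactn where
  toRelFactn : RelFactn C
  functorial : toRelFactn.IsFunctorial

variable (C) in
/-- Functorial factorizations on `C`. -/
structure FFactn where
  toFactn : Factn C
  functorial : toFactn.IsFunctorial

/-- A natural transformation of functorial relations, over the identity. -/
@[ext]
structure FReln.Hom (R S : FReln C) where
  hom : R.toReln ⟶ S.toReln
  naturality : ∀ {X Y : C} (f : X ⟶ Y),
    R.toReln.map f ≫ Reln.Hom.app hom Y = Reln.Hom.app hom X ≫ S.toReln.map f

/-- A natural transformation of functorial relational factorizations, over the identity. -/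
@[ext]
structure FRelFactn.Hom (P Q : FRelFactn C) where
  hom : P.toRelFactn ⟶ Q.toRelFactn
  naturality : ∀ {X Y W Z : C} {f : X ⟶ Y} {g : W ⟶ Z} (α : X ⟶ W) (β : Y ⟶ Z)
    (w : f ≫ β = α ≫ g),
    P.toRelFactn.map α β w ≫ RelFactn.Hom.app hom g =
      RelFactn.Hom.app hom f ≫ Q.toRelFactn.map α β w

/-- A natural transformation of functorial factorizations, over the identity. -/
@[ext]
structure FFactn.Hom (F G : FFactn C) where
  hom : F.toFactn ⟶ G.toFactn
  naturality : ∀ {X Y W Z : C} {f : X ⟶ Y} {g : W ⟶ Z} (α : X ⟶ W) (β : Y ⟶ Z)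
    (w : f ≫ β = α ≫ g),
    F.toFactn.map α β w ≫ Factn.Hom.app hom g = Factn.Hom.app hom f ≫ G.toFactn.map α β w

instance : Category (FReln C) where
  Hom := FReln.Hom
  id R := ⟨𝟙 R.toReln, fun f => (Category.comp_id _).trans (Category.id_comp _).symm⟩
  comp a b := ⟨a.hom ≫ b.hom, fun {X Y} f => by
    change _ ≫ Reln.Hom.app a.hom Y ≫ Reln.Hom.app b.hom Y =
      (Reln.Hom.app a.hom X ≫ Reln.Hom.app b.hom X) ≫ _
    rw [← Category.assoc, a.naturality, Category.assoc, b.naturality, Category.assoc]⟩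
  id_comp a := FReln.Hom.ext (Category.id_comp _)
  comp_id a := FReln.Hom.ext (Category.comp_id _)
  assoc a b c := FReln.Hom.ext (Category.assoc _ _ _)

instance : Category (FRelFactn C) where
  Hom := FRelFactn.Hom
  id P := ⟨𝟙 P.toRelFactn, fun _ _ _ => (Category.comp_id _).trans (Category.id_comp _).symm⟩
  comp a b := ⟨a.hom ≫ b.hom, fun {_ _ _ _ f g} α β w => by
    change _ ≫ RelFactn.Hom.app a.hom g ≫ RelFactn.Hom.app b.hom g =
      (RelFactn.Hom.app a.hom f ≫ RelFactn.Hom.app b.hom f) ≫ _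
    rw [← Category.assoc, a.naturality, Category.assoc, b.naturality, Category.assoc]⟩
  id_comp a := FRelFactn.Hom.ext (Category.id_comp _)
  comp_id a := FRelFactn.Hom.ext (Category.comp_id _)
  assoc a b c := FRelFactn.Hom.ext (Category.assoc _ _ _)

instance : Category (FFactn C) where
  Hom := FFactn.Hom
  id F := ⟨𝟙 F.toFactn, fun _ _ _ => (Category.comp_id _).trans (Category.id_comp _).symm⟩
  comp a b := ⟨a.hom ≫ b.hom, fun {_ _ _ _ f g} α β w => by
    change _ ≫ Factn.Hom.app a.hom g ≫ Factn.Hom.app b.hom g =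
      (Factn.Hom.app a.hom f ≫ Factn.Hom.app b.hom f) ≫ _
    rw [← Category.assoc, a.naturality, Category.assoc, b.naturality, Category.assoc]⟩
  id_comp a := FFactn.Hom.ext (Category.id_comp _)
  comp_id a := FFactn.Hom.ext (Category.comp_id _)
  assoc a b c := FFactn.Hom.ext (Category.assoc _ _ _)

variable (C) in
/-- The inclusion of functorial relations into relations. -/
def FReln.incl : FReln C ⥤ Reln C where
  obj R := R.toReln
  map a := a.hom

variable (C) in
/-- The inclusion of functorial factorizations into factorizations. -/
def FFactn.incl : FFactn C ⥤ Factn C where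
  obj F := F.toFactn
  map a := a.hom

end Categories

/-! ### The functors between relations, relational factorizations and factorizations -/

noncomputable section Functors

variable {C : Type u} [Category.{v} C] [HasFiniteLimits C]

/-- The mapping path object `X ×_Y Ψ Y`, the pullback of `f : X ⟶ Y` and `ε₀`. -/
abbrev Reln.pathObj (R : Reln C) {X Y : C} (f : X ⟶ Y) : C := pullback f (R.ε₀ Y)

/-- The morphism `(1, η f) : X ⟶ X ×_Y Ψ Y`. -/
abbrev Reln.pathL (R : Reln C) {X Y : C} (f : X ⟶ Y) : X ⟶ R.pathObj f :=
  pullback.lift (𝟙 X) (f ≫ R.η Y) (by simp [R.η_ε₀])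

/-- The morphism `α × R β` between mapping path objects. -/
abbrev Reln.pathMap (R : Reln C) {X Y W Z : C} {f : X ⟶ Y} {g : W ⟶ Z} (α : X ⟶ W) (β : Y ⟶ Z)
    (w : f ≫ β = α ≫ g) : R.pathObj f ⟶ R.pathObj g :=
  pullback.lift (pullback.fst f (R.ε₀ Y) ≫ α) (pullback.snd f (R.ε₀ Y) ≫ R.map β)
    (by rw [Category.assoc, Category.assoc, R.map_ε₀, ← w, pullback.condition_assoc])

/-- The morphism `1 × a` between mapping path objects. -/
abbrev Reln.Hom.pathApp {R S : Reln C} (a : Reln.Hom R S) {X Y : C} (f : X ⟶ Y) :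
    R.pathObj f ⟶ S.pathObj f :=
  pullback.lift (pullback.fst f (R.ε₀ Y)) (pullback.snd f (R.ε₀ Y) ≫ a.app Y)
    (by rw [Category.assoc, a.app_ε₀, pullback.condition])

theorem Reln.pathL_map (R : Reln C) {X Y W Z : C} {f : X ⟶ Y} {g : W ⟶ Z} (α : X ⟶ W)
    (β : Y ⟶ Z) (w : f ≫ β = α ≫ g) : R.pathL f ≫ R.pathMap α β w = α ≫ R.pathL g := by
  apply pullback.hom_ext
  · simp [pullback.lift_fst, pullback.lift_snd, pullback.lift_fst_assoc,
      pullback.lift_snd_assoc]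
  · simp [pullback.lift_fst, pullback.lift_snd, pullback.lift_fst_assoc,
      pullback.lift_snd_assoc, R.η_map, reassoc_of% w]

theorem Reln.pathMap_fst (R : Reln C) {X Y W Z : C} {f : X ⟶ Y} {g : W ⟶ Z} (α : X ⟶ W)
    (β : Y ⟶ Z) (w : f ≫ β = α ≫ g) :
    R.pathMap α β w ≫ pullback.fst g (R.ε₀ Z) = pullback.fst f (R.ε₀ Y) ≫ α := by
  simp [pullback.lift_fst, pullback.lift_snd, pullback.lift_fst_assoc,
      pullback.lift_snd_assoc]

theorem Reln.pathMap_r (R : Reln C) {X Y W Z : C} {f : X ⟶ Y} {g : W ⟶ Z} (α : X ⟶ W)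
    (β : Y ⟶ Z) (w : f ≫ β = α ≫ g) :
    R.pathMap α β w ≫ pullback.snd g (R.ε₀ Z) ≫ R.ε₁ Z =
      (pullback.snd f (R.ε₀ Y) ≫ R.ε₁ Y) ≫ β := by
  simp [pullback.lift_fst, pullback.lift_snd, pullback.lift_fst_assoc,
      pullback.lift_snd_assoc, R.map_ε₁]

theorem Reln.Hom.pathL_app {R S : Reln C} (a : Reln.Hom R S) {X Y : C} (f : X ⟶ Y) :
    R.pathL f ≫ a.pathApp f = S.pathL f := by
  apply pullback.hom_ext
  · simp [pullback.lift_fst, pullback.lift_snd, pullback.lift_fst_assoc,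
      pullback.lift_snd_assoc]
  · simp [pullback.lift_fst, pullback.lift_snd, pullback.lift_fst_assoc,
      pullback.lift_snd_assoc, a.η_app]

theorem Reln.Hom.pathApp_r {R S : Reln C} (a : Reln.Hom R S) {X Y : C} (f : X ⟶ Y) :
    a.pathApp f ≫ pullback.snd f (S.ε₀ Y) ≫ S.ε₁ Y = pullback.snd f (R.ε₀ Y) ≫ R.ε₁ Y := by
  simp [pullback.lift_fst, pullback.lift_snd, pullback.lift_fst_assoc,
      pullback.lift_snd_assoc, a.app_ε₁]

theorem Reln.Hom.pathApp_comp {R S T : Reln C} (a : R ⟶ S) (b : S ⟶ T) {X Y : C} (f : X ⟶ Y) :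
    Reln.Hom.pathApp (a ≫ b) f = Reln.Hom.pathApp a f ≫ Reln.Hom.pathApp b f := by
  have h : Reln.Hom.app (a ≫ b) Y = Reln.Hom.app a Y ≫ Reln.Hom.app b Y := rfl
  apply pullback.hom_ext
  · simp [pullback.lift_fst, pullback.lift_snd, pullback.lift_fst_assoc,
      pullback.lift_snd_assoc]
  · simp [pullback.lift_fst, pullback.lift_snd, pullback.lift_fst_assoc,
      pullback.lift_snd_assoc, h]

theorem Reln.Hom.pathApp_id (R : Reln C) {X Y : C} (f : X ⟶ Y) :
    Reln.Hom.pathApp (𝟙 R) f = 𝟙 (R.pathObj f) := by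
  have h : Reln.Hom.app (𝟙 R) Y = 𝟙 (R.Ψ Y) := rfl
  apply pullback.hom_ext
  · simp [pullback.lift_fst, pullback.lift_snd, pullback.lift_fst_assoc,
      pullback.lift_snd_assoc]
  · simp [pullback.lift_fst, pullback.lift_snd, pullback.lift_fst_assoc,
      pullback.lift_snd_assoc, h]

/-- `σ_*` on objects: a morphism `f : X ⟶ Y` is sent to
`X ⟶ X ×_Y Ψ Y ⟶ Y`, the pullback being that of `f` and `ε₀`, with the projection to `X`. -/
def Reln.sigmaPush (R : Reln C) : RelFactn C where
  Φ f := R.pathObj f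
  l f := R.pathL f
  κ {_ Y} f := pullback.fst f (R.ε₀ Y)
  r {_ Y} f := pullback.snd f (R.ε₀ Y) ≫ R.ε₁ Y
  l_κ f := pullback.lift_fst _ _ _
  l_r {_ Y} f := by
    rw [pullback.lift_snd_assoc, Category.assoc, R.η_ε₁, Category.comp_id]
  map α β w := R.pathMap α β w
  l_map α β w := R.pathL_map α β w
  map_κ α β w := R.pathMap_fst α β w
  map_r α β w := R.pathMap_r α β w

variable (C) in
/-- The functor `σ_*` from relations to relational factorizations. -/
def sigmaPush : Reln C ⥤ RelFactn C where
  obj R := R.sigmaPush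
  map a := ⟨Reln.Hom.pathApp a, Reln.Hom.pathL_app a, fun _ => pullback.lift_fst _ _ _,
    Reln.Hom.pathApp_r a⟩
  map_id R := RelFactn.Hom.ext (funext fun _ => funext fun _ => funext fun f =>
    Reln.Hom.pathApp_id R f)
  map_comp a b := RelFactn.Hom.ext (funext fun _ => funext fun _ => funext fun f =>
    Reln.Hom.pathApp_comp a b f)

variable (C) in
/-- The functor `ι_*` which forgets the retraction of a relational factorization. -/
def iotaPush : RelFactn C ⥤ Factn C where
  obj P :=
    { Φ := P.Φ, l := P.l, r := P.r, l_r := P.l_r, map := P.map, l_map := P.l_map,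
      map_r := P.map_r }
  map a := ⟨RelFactn.Hom.app a, RelFactn.Hom.l_app a, RelFactn.Hom.app_r a⟩

/-- The graph `(1, f) : X ⟶ X × Y` of a morphism `f : X ⟶ Y`. -/
abbrev graphHom {X Y : C} (f : X ⟶ Y) : X ⟶ X ⨯ Y := prod.lift (𝟙 X) f

theorem graphHom_comm {X Y W Z : C} {f : X ⟶ Y} {g : W ⟶ Z} {α : X ⟶ W} {β : Y ⟶ Z}
    (w : f ≫ β = α ≫ g) : graphHom f ≫ prod.map α β = α ≫ graphHom g := by
  apply Limits.prod.hom_ext <;> simp [w]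

/-- `ι^*` on objects: a morphism `f : X ⟶ Y` is sent to the given factorization of
`(1, f) : X ⟶ X × Y`, composed with the two projections. -/
def Factn.iotaPull (F : Factn C) : RelFactn C where
  Φ f := F.Φ (graphHom f)
  l f := F.l (graphHom f)
  κ f := F.r (graphHom f) ≫ prod.fst
  r f := F.r (graphHom f) ≫ prod.snd
  l_κ f := by rw [← Category.assoc, F.l_r, prod.lift_fst]
  l_r f := by rw [← Category.assoc, F.l_r, prod.lift_snd]
  map α β w := F.map α (prod.map α β) (graphHom_comm w)
  l_map α β w := F.l_map _ _ _
  map_κ α β w := by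
    rw [← Category.assoc, F.map_r, Category.assoc, Category.assoc, prod.map_fst]
  map_r α β w := by
    rw [← Category.assoc, F.map_r, Category.assoc, Category.assoc, prod.map_snd]

variable (C) in
/-- The functor `ι^*` from factorizations to relational factorizations. -/
def iotaPull : Factn C ⥤ RelFactn C where
  obj F := F.iotaPull
  map {F G} a :=
    { app := fun f => Factn.Hom.app a (graphHom f)
      l_app := fun f => Factn.Hom.l_app a (graphHom f)
      app_κ := fun f => by
        simp only [Factn.iotaPull]
        rw [← Category.assoc, Factn.Hom.app_r]
      app_r := fun f => by
        simp only [Factn.iotaPull]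
        rw [← Category.assoc, Factn.Hom.app_r] }

/-- `σ^*` on objects: restriction of a relational factorization to identity morphisms. -/
def RelFactn.sigmaPull (P : RelFactn C) : Reln C where
  Ψ X := P.Φ (𝟙 X)
  η X := P.l (𝟙 X)
  ε₀ X := P.κ (𝟙 X)
  ε₁ X := P.r (𝟙 X)
  η_ε₀ X := P.l_κ _
  η_ε₁ X := P.l_r _
  map f := P.map f f (by simp)
  η_map f := P.l_map f f _
  map_ε₀ f := P.map_κ f f _
  map_ε₁ f := P.map_r f f _

variable (C) in
/-- The functor `σ^*` from relational factorizations to relations. -/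
def sigmaPull : RelFactn C ⥤ Reln C where
  obj P := P.sigmaPull
  map a :=
    { app := fun X => RelFactn.Hom.app a (𝟙 X)
      η_app := fun X => RelFactn.Hom.l_app a _
      app_ε₀ := fun X => RelFactn.Hom.app_κ a _
      app_ε₁ := fun X => RelFactn.Hom.app_r a _ }

variable (C) in
/-- `𝔐 = ι_* σ_*`. -/
def relToFact : Reln C ⥤ Factn C := sigmaPush C ⋙ iotaPush C

variable (C) in
/-- `Ξ = σ^* ι^*`. -/
def factToRel : Factn C ⥤ Reln C := iotaPull C ⋙ sigmaPull C

theorem Reln.IsFunctorial.sigmaPush {R : Reln C} (h : R.IsFunctorial) :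
    R.sigmaPush.IsFunctorial where
  map_id {X Y} f w := by
    change R.pathMap (𝟙 X) (𝟙 Y) w = 𝟙 (R.pathObj f)
    apply pullback.hom_ext <;> simp [pullback.lift_fst, pullback.lift_snd, pullback.lift_fst_assoc,
      pullback.lift_snd_assoc, h.map_id]
  map_comp {_ _ _ _ _ _ f f' f''} α β α' β' w w' w'' := by
    change R.pathMap (α ≫ α') (β ≫ β') w'' = R.pathMap α β w ≫ R.pathMap α' β' w'
    apply pullback.hom_ext <;> simp [pullback.lift_fst, pullback.lift_snd, pullback.lift_fst_assoc,
      pullback.lift_snd_assoc, h.map_comp]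

theorem FReln.Hom.pathApp_naturality {R S : FReln C} (a : FReln.Hom R S) {X Y W Z : C}
    {f : X ⟶ Y} {g : W ⟶ Z} (α : X ⟶ W) (β : Y ⟶ Z) (w : f ≫ β = α ≫ g) :
    R.toReln.pathMap α β w ≫ Reln.Hom.pathApp a.hom g =
      Reln.Hom.pathApp a.hom f ≫ S.toReln.pathMap α β w := by
  apply pullback.hom_ext <;> simp [pullback.lift_fst, pullback.lift_snd, pullback.lift_fst_assoc,
      pullback.lift_snd_assoc, a.naturality]

variable (C) in
/-- The functorial version of `σ_*`. -/
def fsigmaPush : FReln C ⥤ FRelFactn C where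
  obj R := ⟨R.toReln.sigmaPush, R.functorial.sigmaPush⟩
  map a := ⟨(sigmaPush C).map a.hom, a.pathApp_naturality⟩
  map_id R := FRelFactn.Hom.ext ((sigmaPush C).map_id _)
  map_comp a b := FRelFactn.Hom.ext ((sigmaPush C).map_comp _ _)

variable (C) in
/-- The functorial version of `ι_*`. -/
def fiotaPush : FRelFactn C ⥤ FFactn C where
  obj P := ⟨(iotaPush C).obj P.toRelFactn, ⟨P.functorial.map_id, P.functorial.map_comp⟩⟩
  map a := ⟨(iotaPush C).map a.hom, a.naturality⟩

variable (C) in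
/-- The functorial version of `ι^*`. -/
def fiotaPull : FFactn C ⥤ FRelFactn C where
  obj F := ⟨(iotaPull C).obj F.toFactn, by
    refine ⟨fun {X Y} f w => ?_, fun α β α' β' w w' w'' => ?_⟩
    · change F.toFactn.map _ (prod.map _ _) _ = _
      simp only [prod.map_id_id]
      exact F.functorial.map_id _ _
    · change F.toFactn.map _ (prod.map _ _) _ = _
      simp only [← prod.map_map]
      exact F.functorial.map_comp _ _ _ _ _ _ _⟩
  map a := ⟨(iotaPull C).map a.hom, fun _ _ _ => a.naturality _ _ _⟩

variable (C) in
/-- The functorial version of `σ^*`. -/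
def fsigmaPull : FRelFactn C ⥤ FReln C where
  obj P := ⟨(sigmaPull C).obj P.toRelFactn,
    ⟨fun X => P.functorial.map_id _ _, fun f g => P.functorial.map_comp _ _ _ _ _ _ _⟩⟩
  map a := ⟨(sigmaPull C).map a.hom, fun f => a.naturality f f _⟩

variable (C) in
/-- The functorial version of `𝔐`. -/
def frelToFact : FReln C ⥤ FFactn C := fsigmaPush C ⋙ fiotaPush C

variable (C) in
/-- The functorial version of `Ξ`. -/
def ffactToRel : FFactn C ⥤ FReln C := fiotaPull C ⋙ fsigmaPull C

end Functors

/-! ### Type-theoretic weak factorization structures -/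

section TypeTheoretic

variable {C : Type u} [Category.{v} C]

/-- The class of morphisms with an `F`-coalgebra structure. -/
def Factn.coalg (F : Factn C) : MorphismProperty C := fun _ Y f =>
  ∃ s : Y ⟶ F.Φ f, f ≫ s = F.l f ∧ s ≫ F.r f = 𝟙 Y

/-- The class of morphisms with an `F`-algebra structure. -/
def Factn.alg (F : Factn C) : MorphismProperty C := fun X _ f =>
  ∃ s : F.Φ f ⟶ X, F.l f ≫ s = 𝟙 X ∧ s ≫ f = F.r f

/-- A weak factorization structure; its underlying weak factorization system is
`(F.coalg, F.alg)`. -/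
def Factn.IsWFStructure (F : Factn C) : Prop :=
  ∀ {X Y : C} (f : X ⟶ Y), F.coalg (F.l f) ∧ F.alg (F.r f)

/-- The condition on a weak factorization system `(L, R)` to be type-theoretic: all objects are
fibrant, and `L` is stable under pullback along `R`. -/
structure IsTypeTheoretic (L R : MorphismProperty C) : Prop where
  fibrant : ∀ ⦃X T : C⦄, IsTerminal T → ∀ f : X ⟶ T, R f
  pullback_stable : ∀ ⦃P A X Y : C⦄ (p : P ⟶ A) (q : P ⟶ X) (l : A ⟶ Y) (r : X ⟶ Y),
    IsPullback p q l r → L l → R r → L q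

variable (C) in
/-- Type-theoretic weak factorization structures, as a property of factorizations. -/
def isTTWFS : ObjectProperty (Factn C) := fun F =>
  F.IsWFStructure ∧ IsTypeTheoretic F.coalg F.alg

variable (C) in
/-- The category of type-theoretic weak factorization structures. -/
abbrev TTWFS := (isTTWFS C).FullSubcategory

variable (C) in
/-- The category of functorial type-theoretic weak factorization structures. -/
abbrev FTTWFS := ((isTTWFS C).inverseImage (FFactn.incl C)).FullSubcategory

variable (C) in
/-- The inclusion of functorial type-theoretic weak factorization structures. -/
def FTTWFS.incl : FTTWFS C ⥤ TTWFS C :=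
  (isTTWFS C).lift (ObjectProperty.ι _ ⋙ FFactn.incl C) fun F => F.property

end TypeTheoretic

/-! ### `Id`-presentations -/

section IdPresentations

variable {C : Type u} [Category.{v} C] [HasFiniteLimits C]

/-- `R` provides, at the object `X`, an identity type of `X` with respect to the class `D`:
`(ε₀, ε₁)` lies in `D`, and for each `α : A ⟶ X` the pullback `s = α^* η : A ⟶ α^* Ψ X` of `η`
along `α`, formed with `ε₀` or with `ε₁`, has the left lifting property against `D`. -/
structure Reln.IsIdTypeAt (R : Reln C) (D : MorphismProperty C) (X : C) : Prop where
  display : D (prod.lift (R.ε₀ X) (R.ε₁ X))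
  llp₀ : ∀ ⦃A P : C⦄ (α : A ⟶ X) (p : P ⟶ R.Ψ X) (q : P ⟶ A),
    IsPullback p q (R.ε₀ X) α → ∀ s : A ⟶ P, s ≫ p = α ≫ R.η X → s ≫ q = 𝟙 A → D.llp s
  llp₁ : ∀ ⦃A P : C⦄ (α : A ⟶ X) (p : P ⟶ R.Ψ X) (q : P ⟶ A),
    IsPullback p q (R.ε₁ X) α → ∀ s : A ⟶ P, s ≫ p = α ≫ R.η X → s ≫ q = 𝟙 A → D.llp s

variable (C) in
/-- `R` is an `Id`-presentation: `𝔐 R` is a weak factorization structure, and `R` is a model of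
`Id`-types of objects with respect to its right class. -/
def isIdPresentation : ObjectProperty (Reln C) := fun R =>
  ((relToFact C).obj R).IsWFStructure ∧
    ∀ X : C, R.IsIdTypeAt ((relToFact C).obj R).alg X

variable (C) in
/-- The category of `Id`-presentations. -/
abbrev IdPres := (isIdPresentation C).FullSubcategory

variable (C) in
/-- The category of functorial `Id`-presentations. -/
abbrev FIdPres := ((isIdPresentation C).inverseImage (FReln.incl C)).FullSubcategory

variable (C) in
/-- The inclusion of functorial `Id`-presentations. -/
def FIdPres.incl : FIdPres C ⥤ IdPres C :=
  (isIdPresentation C).lift (ObjectProperty.ι _ ⋙ FReln.incl C) fun R => R.property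

end IdPresentations

/-! ### Proset truncation -/

/-- The proset truncation of `D`: the same objects, and `X ≤ Y` if there is a morphism from `X`
to `Y` in `D`. The preorder is viewed as a category. -/
structure Proset (D : Type u) [Category.{v} D] where
  obj : D

instance {D : Type u} [Category.{v} D] : Preorder (Proset D) where
  le X Y := Nonempty (X.obj ⟶ Y.obj)
  le_refl X := ⟨𝟙 X.obj⟩
  le_trans _ _ _ := fun ⟨f⟩ ⟨g⟩ => ⟨f ≫ g⟩

/-- The action of proset truncation on functors. -/
def Proset.map {D : Type*} [Category* D] {E : Type*} [Category* E] (F : D ⥤ E) :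
    Proset D ⥤ Proset E where
  obj X := ⟨F.obj X.obj⟩
  map h := homOfLE ((leOfHom h).map F.map)
  map_id _ := Subsingleton.elim _ _
  map_comp _ _ := Subsingleton.elim _ _

section FunctorialPart

variable (C : Type u) [Category.{v} C]

/-- Those objects of `|TTWFS C|` which are functorial, i.e. come from `FTTWFS C`. -/
def isFunctorialTTWFS : ObjectProperty (Proset (TTWFS C)) := fun F =>
  ∃ G : FTTWFS C, (FTTWFS.incl C).obj G = F.obj

/-- The full subcategory of `|TTWFS C|` on the functorial objects. -/
abbrev ProsetTTWFSFunctorial := (isFunctorialTTWFS C).FullSubcategory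

/-- The canonical functor from `|FTTWFS C|` to the functorial part of `|TTWFS C|`. -/
def toProsetTTWFSFunctorial : Proset (FTTWFS C) ⥤ ProsetTTWFSFunctorial C :=
  (isFunctorialTTWFS C).lift (Proset.map (FTTWFS.incl C)) fun F => ⟨F.obj, rfl⟩

variable [HasFiniteLimits C]

/-- Those objects of `|IdPres C|` which are functorial, i.e. come from `FIdPres C`. -/
def isFunctorialIdPres : ObjectProperty (Proset (IdPres C)) := fun R =>
  ∃ S : FIdPres C, (FIdPres.incl C).obj S = R.obj

/-- The full subcategory of `|IdPres C|` on the functorial objects. -/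
abbrev ProsetIdPresFunctorial := (isFunctorialIdPres C).FullSubcategory

/-- The canonical functor from `|FIdPres C|` to the functorial part of `|IdPres C|`. -/
def toProsetIdPresFunctorial : Proset (FIdPres C) ⥤ ProsetIdPresFunctorial C :=
  (isFunctorialIdPres C).lift (Proset.map (FIdPres.incl C)) fun R => ⟨R.obj, rfl⟩

end FunctorialPart

/-! ### Weak factorization structures and their lifting properties -/

section WeakFactorizationStructures

variable {C : Type u} [Category.{v} C] {F : Factn C}

/-! A relation acts as a choice of path objects `Ψ X`, and `𝔐` forms mapping path objects from it.
The left class of `𝔐 R` therefore consists of the strong deformation retracts with respect to `R`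
(`relToFact_coalg_iff`). The other basic tool is that two maps into `X` that agree after composition
with a left map are homotopic relative to it, as soon as `(ε₀, ε₁)` is a right map
(`Reln.exists_homotopy`).

For an `Id`-presentation, fibrancy is automatic: the projection of the mapping path object is an
algebra structure over a terminal object. Pullback stability of left maps is the Frobenius argument:
paths in the base are transported along a right map, which turns a deformation of the base into one
of the total space (`isIdPresentation.coalg_of_isPullback`).

Conversely, let `F` be type-theoretic. Left maps have retractions, and by the homotopy lemma these
are strong deformation retractions for `Ξ F`. Hence `F` and `𝔐 Ξ F` have the same left and right
classes (`coalg_eq`, `alg_eq`). The `Id`-type axioms need sections such as `η` to remain left maps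
after base change along arbitrary maps, whereas the hypothesis covers only base change along right
maps. The gap is closed by factoring the base map and cancelling left maps (`coalg_section`).

Both composites thus preserve the underlying weak factorization system, and lifting the left part of
one object against the right part of another gives comparison morphisms both ways. These lifts are
chosen one object or arrow at a time and need not be natural, so the functorial equivalence is
between full subcategories of the truncations of the nonfunctorial categories. -/

theorem Factn.exists_lift {A B X Y : C} {f : A ⟶ B} {g : X ⟶ Y} (hf : F.coalg f) (hg : F.alg g)
    (a : A ⟶ X) (b : B ⟶ Y) (w : a ≫ g = f ≫ b) : ∃ d : B ⟶ X, f ≫ d = a ∧ d ≫ g = b := by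
  obtain ⟨s, hs, hs'⟩ := hf
  obtain ⟨t, ht, ht'⟩ := hg
  -- Only some morphism `Φ f ⟶ Φ g` over the square is needed, so functoriality of `F` plays no
  -- role.
  refine ⟨s ≫ F.map a b w.symm ≫ t, ?_, ?_⟩
  · rw [reassoc_of% hs, ← Category.assoc, F.l_map, Category.assoc, ht, Category.comp_id]
  · rw [Category.assoc, Category.assoc, ht', F.map_r, reassoc_of% hs']

theorem Factn.coalg_le_llp (F : Factn C) : F.coalg ≤ F.alg.llp := fun _ _ _ hf _ _ _ hg =>
  ⟨fun {a b} sq => by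
    obtain ⟨d, h₁, h₂⟩ := Factn.exists_lift hf hg a b sq.w
    exact ⟨⟨⟨d, h₁, h₂⟩⟩⟩⟩

theorem Factn.alg_le_rlp (F : Factn C) : F.alg ≤ F.coalg.rlp := fun _ _ _ hg _ _ _ hf =>
  F.coalg_le_llp _ hf _ hg

theorem MorphismProperty.llp.exists_lift {D : MorphismProperty C} {A B X Y : C} {f : A ⟶ B}
    {g : X ⟶ Y} (hf : D.llp f) (hg : D g) (a : A ⟶ X) (b : B ⟶ Y) (w : a ≫ g = f ≫ b) :
    ∃ d : B ⟶ X, f ≫ d = a ∧ d ≫ g = b := by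
  have := hf g hg
  have sq : CommSq a f g b := ⟨w⟩
  exact ⟨sq.lift, sq.fac_left, sq.fac_right⟩

/-- Retract argument: lifting `f` against its own right factor yields the coalgebra structure. -/
theorem Factn.IsWFStructure.coalg_eq_llp (hF : F.IsWFStructure) : F.coalg = F.alg.llp := by
  refine le_antisymm F.coalg_le_llp fun X Y f hf => ?_
  obtain ⟨d, h₁, h₂⟩ := MorphismProperty.llp.exists_lift hf (hF f).2 (F.l f) (𝟙 Y)
    (by rw [F.l_r, Category.comp_id])
  exact ⟨d, h₁, h₂⟩

theorem Factn.IsWFStructure.alg_eq_rlp (hF : F.IsWFStructure) : F.alg = F.coalg.rlp := by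
  refine le_antisymm F.alg_le_rlp fun X Y f hf => ?_
  have := hf (F.l f) (hF f).1
  have sq : CommSq (𝟙 X) (F.l f) f (F.r f) := ⟨by rw [F.l_r, Category.id_comp]⟩
  exact ⟨sq.lift, sq.fac_left, sq.fac_right⟩

theorem Factn.IsWFStructure.coalg_comp (hF : F.IsWFStructure) {X Y Z : C} {f : X ⟶ Y}
    {g : Y ⟶ Z} (hf : F.coalg f) (hg : F.coalg g) : F.coalg (f ≫ g) := by
  rw [hF.coalg_eq_llp] at *
  exact F.alg.llp.comp_mem f g hf hg

theorem Factn.IsWFStructure.alg_comp (hF : F.IsWFStructure) {X Y Z : C} {f : X ⟶ Y}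
    {g : Y ⟶ Z} (hf : F.alg f) (hg : F.alg g) : F.alg (f ≫ g) := by
  rw [hF.alg_eq_rlp] at *
  exact F.coalg.rlp.comp_mem f g hf hg

theorem Factn.IsWFStructure.alg_of_isPullback (hF : F.IsWFStructure) {P X Y Z : C} {p : P ⟶ X}
    {q : P ⟶ Y} {f : X ⟶ Z} {g : Y ⟶ Z} (h : IsPullback p q f g) (hg : F.alg g) : F.alg p := by
  rw [hF.alg_eq_rlp] at *
  exact F.coalg.rlp.of_isPullback h.flip hg

open Factn in
/-- In a type-theoretic weak factorization structure, the section of a pulled back fibration with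
a section in the left class is in the left class, if the pullback is along a fibration. -/
theorem isTTWFS.coalg_section_of_alg (hF : isTTWFS C F) {A P W X : C} {e : W ⟶ X} {η : X ⟶ W}
    (hη : F.coalg η) {α : A ⟶ X} (hα : F.alg α) {p : P ⟶ W} {q : P ⟶ A} (h : IsPullback p q e α)
    (hηe : η ≫ e = 𝟙 X) {s : A ⟶ P} (hp : s ≫ p = α ≫ η) (hq : s ≫ q = 𝟙 A) : F.coalg s := by
  -- Pasted with the given pullback, this square becomes the one with identities along `α`, so by
  -- cancellation `s` is the base change of `η` along `p`. In turn `p` is a base change of the right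
  -- map `α`.
  have key : IsPullback s α p η := IsPullback.of_right (h₁₂ := q) (h₂₂ := e) (v₁₃ := α)
    (by rw [hq, hηe]; exact IsPullback.of_id_fst) hp h.flip
  exact hF.2.pullback_stable _ _ _ _ key.flip hη (IsWFStructure.alg_of_isPullback hF.1 h hα)

end WeakFactorizationStructures

/-! ### From `Id`-presentations to type-theoretic structures -/

section Relations

variable {C : Type u} [Category.{v} C] [HasFiniteLimits C]

/-- The left class of `𝔐 R` consists of the strong deformation retracts with respect to `R`. -/
theorem relToFact_coalg_iff {R : Reln C} {X Y : C} {f : X ⟶ Y} :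
    ((relToFact C).obj R).coalg f ↔ ∃ (k : Y ⟶ X) (h : Y ⟶ R.Ψ Y), f ≫ k = 𝟙 X ∧
      f ≫ h = f ≫ R.η Y ∧ h ≫ R.ε₀ Y = k ≫ f ∧ h ≫ R.ε₁ Y = 𝟙 Y := by
  constructor
  · rintro ⟨s, hs, hs'⟩
    change Y ⟶ R.pathObj f at s
    change f ≫ s = R.pathL f at hs
    change s ≫ pullback.snd f (R.ε₀ Y) ≫ R.ε₁ Y = 𝟙 Y at hs'
    refine ⟨s ≫ pullback.fst _ _, s ≫ pullback.snd _ _, ?_, ?_, ?_, ?_⟩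
    · rw [reassoc_of% hs, pullback.lift_fst]
    · rw [reassoc_of% hs, pullback.lift_snd]
    · rw [Category.assoc, Category.assoc, pullback.condition]
    · rw [Category.assoc, hs']
  · rintro ⟨k, h, h₁, h₂, h₃, h₄⟩
    refine ⟨pullback.lift k h h₃.symm, ?_, ?_⟩
    · change f ≫ pullback.lift k h h₃.symm = R.pathL f
      apply pullback.hom_ext
      · rw [Category.assoc, pullback.lift_fst, pullback.lift_fst, h₁]
      · rw [Category.assoc, pullback.lift_snd, pullback.lift_snd, h₂]
    · change pullback.lift k h h₃.symm ≫ pullback.snd f (R.ε₀ Y) ≫ R.ε₁ Y = 𝟙 Y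
      rw [pullback.lift_snd_assoc, h₄]

theorem Reln.pathL_fst (R : Reln C) {X Y : C} (f : X ⟶ Y) :
    R.pathL f ≫ pullback.fst f (R.ε₀ Y) = 𝟙 X := pullback.lift_fst _ _ _

theorem Reln.pathL_snd (R : Reln C) {X Y : C} (f : X ⟶ Y) :
    R.pathL f ≫ pullback.snd f (R.ε₀ Y) = f ≫ R.η Y := pullback.lift_snd _ _ _

theorem Reln.η_lift (R : Reln C) (X : C) :
    R.η X ≫ prod.lift (R.ε₀ X) (R.ε₁ X) = prod.lift (𝟙 X) (𝟙 X) := by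
  rw [prod.comp_lift, R.η_ε₀, R.η_ε₁]

/-- Two maps into `X` which agree on a map lifting against `(ε₀, ε₁)` are homotopic relative to
that map. -/
theorem Reln.exists_homotopy {R : Reln C} {D : MorphismProperty C} {X : C}
    (hX : D (prod.lift (R.ε₀ X) (R.ε₁ X))) {A B : C} {f : A ⟶ B} (hf : D.llp f)
    {a b : B ⟶ X} (w : f ≫ a = f ≫ b) :
    ∃ H : B ⟶ R.Ψ X, f ≫ H = f ≫ a ≫ R.η X ∧ H ≫ R.ε₀ X = a ∧ H ≫ R.ε₁ X = b := by
  obtain ⟨H, h₁, h₂⟩ := MorphismProperty.llp.exists_lift hf hX (f ≫ a ≫ R.η X) (prod.lift a b) (by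
    rw [Category.assoc, Category.assoc, R.η_lift]
    apply Limits.prod.hom_ext <;> simp [w])
  refine ⟨H, h₁, ?_, ?_⟩
  · simpa [prod.lift_fst, prod.lift_snd] using h₂ =≫ prod.fst
  · simpa [prod.lift_fst, prod.lift_snd] using h₂ =≫ prod.snd

/-- Over a terminal object the compatibility with `f` is vacuous, so projecting the mapping path
object to `X` is an algebra structure. -/
theorem Reln.fibrant (R : Reln C) {X T : C} (hT : IsTerminal T) (f : X ⟶ T) :
    ((relToFact C).obj R).alg f :=
  ⟨pullback.fst f (R.ε₀ T), R.pathL_fst f, hT.hom_ext _ _⟩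

theorem Reln.IsIdTypeAt.llp_η {R : Reln C} {D : MorphismProperty C} {X : C}
    (h : R.IsIdTypeAt D X) : D.llp (R.η X) :=
  h.llp₀ (𝟙 X) (𝟙 _) (R.ε₀ X) IsPullback.of_id_fst (R.η X) (by simp) (R.η_ε₀ X)

/-- The Frobenius condition for the weak factorization system of an `Id`-presentation. -/
theorem isIdPresentation.coalg_of_isPullback {R : Reln C} (hR : isIdPresentation C R)
    {P A X Y : C} {p : P ⟶ A} {q : P ⟶ X} {l : A ⟶ Y} {r : X ⟶ Y} (sq : IsPullback p q l r)
    (hl : ((relToFact C).obj R).coalg l) (hr : ((relToFact C).obj R).alg r) :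
    ((relToFact C).obj R).coalg q := by
  obtain ⟨k, h, hk, hlh, hε₀, hε₁⟩ := relToFact_coalg_iff.1 hl
  -- The pullback consists of pairs of a path in `Y` and a point of `X` over its end; `n` pairs a
  -- point with the constant path.
  let n : X ⟶ pullback (R.ε₁ Y) r := pullback.lift (r ≫ R.η Y) (𝟙 X) (by simp [R.η_ε₁])
  have hn₁ : n ≫ pullback.fst _ _ = r ≫ R.η Y := pullback.lift_fst _ _ _
  have hn₂ : n ≫ pullback.snd _ _ = 𝟙 X := pullback.lift_snd _ _ _
  have hn := (hR.2 Y).llp₁ r _ _ (IsPullback.of_hasPullback (R.ε₁ Y) r) n hn₁ hn₂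
  -- Backward transport: `t` moves the point to one over the start of the path, and fixes it along
  -- constant paths.
  obtain ⟨t, hnt, htr⟩ := MorphismProperty.llp.exists_lift hn hr (𝟙 X)
    (pullback.fst (R.ε₁ Y) r ≫ R.ε₀ Y) (by simp [reassoc_of% hn₁, R.η_ε₀])
  -- The homotopy `K` joins the transported point to the original one, and is constant along
  -- constant paths.
  obtain ⟨K, hnK, hK₀, hK₁⟩ := Reln.exists_homotopy (hR.2 X).display hn
    (a := t) (b := pullback.snd _ _) (by rw [hnt, hn₂])
  -- Each point of `X` is paired with the path of the deformation `h` ending below it. Transport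
  -- along that path lands over the image of `l`, which gives the retraction onto `P`. Since `h` is
  -- constant on `A`, `m` and `n` agree on `P`.
  let m : X ⟶ pullback (R.ε₁ Y) r := pullback.lift (r ≫ h) (𝟙 X) (by simp [hε₁])
  have hm₁ : m ≫ pullback.fst _ _ = r ≫ h := pullback.lift_fst _ _ _
  have hm₂ : m ≫ pullback.snd _ _ = 𝟙 X := pullback.lift_snd _ _ _
  have hqm : q ≫ m = q ≫ n := by
    apply pullback.hom_ext
    · rw [Category.assoc, Category.assoc, hm₁, hn₁, ← sq.w_assoc, hlh, sq.w_assoc]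
    · rw [Category.assoc, Category.assoc, hm₂, hn₂]
  have w : (r ≫ k) ≫ l = (m ≫ t) ≫ r := by
    rw [Category.assoc, Category.assoc, htr, reassoc_of% hm₁, hε₀]
  refine relToFact_coalg_iff.2 ⟨sq.lift (r ≫ k) (m ≫ t) w, m ≫ K, ?_, ?_, ?_, ?_⟩
  · apply sq.hom_ext
    · rw [Category.assoc, sq.lift_fst, Category.id_comp, ← sq.w_assoc, hk, Category.comp_id]
    · rw [Category.assoc, sq.lift_snd, reassoc_of% hqm, hnt, Category.comp_id, Category.id_comp]
  · rw [reassoc_of% hqm, hnK, reassoc_of% hnt]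
  · rw [sq.lift_snd, Category.assoc, hK₀]
  · rw [Category.assoc, hK₁, hm₂]

theorem isIdPresentation.isTTWFS {R : Reln C} (hR : isIdPresentation C R) :
    isTTWFS C ((relToFact C).obj R) :=
  ⟨hR.1, fun _ _ hT f => R.fibrant hT f, fun _ _ _ _ _ _ _ _ sq hl hr =>
    hR.coalg_of_isPullback sq hl hr⟩

-- From type-theoretic structures to `Id`-presentations

end Relations

section Factorizations

open Factn

variable {C : Type u} [Category.{v} C] [HasFiniteLimits C] {F : Factn C}

theorem factToRel_prod_lift (F : Factn C) (X : C) :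
    prod.lift (((factToRel C).obj F).ε₀ X) (((factToRel C).obj F).ε₁ X) =
      F.r (graphHom (𝟙 X)) :=
  Limits.prod.hom_ext (prod.lift_fst _ _) (prod.lift_snd _ _)

theorem Factn.IsWFStructure.coalg_factToRel_η (hF : F.IsWFStructure) (X : C) :
    F.coalg (((factToRel C).obj F).η X) := (hF (graphHom (𝟙 X))).1

theorem Factn.IsWFStructure.alg_factToRel (hF : F.IsWFStructure) (X : C) :
    F.alg (prod.lift (((factToRel C).obj F).ε₀ X) (((factToRel C).obj F).ε₁ X)) := by
  rw [factToRel_prod_lift]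
  exact (hF _).2

namespace isTTWFS

theorem alg_fst (hF : isTTWFS C F) (X Y : C) : F.alg (prod.fst : X ⨯ Y ⟶ X) :=
  IsWFStructure.alg_of_isPullback hF.1 (IsPullback.of_hasBinaryProduct' X Y)
    (hF.2.fibrant terminalIsTerminal _)

theorem alg_snd (hF : isTTWFS C F) (X Y : C) : F.alg (prod.snd : X ⨯ Y ⟶ Y) :=
  IsWFStructure.alg_of_isPullback hF.1 (IsPullback.of_hasBinaryProduct' X Y).flip
    (hF.2.fibrant terminalIsTerminal _)

theorem alg_ε₀ (hF : isTTWFS C F) (X : C) : F.alg (((factToRel C).obj F).ε₀ X) :=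
  IsWFStructure.alg_comp hF.1 (hF.1 _).2 (hF.alg_fst X X)

theorem alg_ε₁ (hF : isTTWFS C F) (X : C) : F.alg (((factToRel C).obj F).ε₁ X) :=
  IsWFStructure.alg_comp hF.1 (hF.1 _).2 (hF.alg_snd X X)

/-- For `f` in the right class, `pathL f` is the base change of `η` along a right map, hence a left
map. It lifts against `f`, and the filler is the algebra structure. For general `f`, that `pathL f`
is a left map is only available later, in `coalg_pathL`. -/
theorem alg_le (hF : isTTWFS C F) :
    F.alg ≤ ((relToFact C).obj ((factToRel C).obj F)).alg := fun X Y f hf => by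
  set R := (factToRel C).obj F
  obtain ⟨d, h₁, h₂⟩ := Factn.exists_lift
    (hF.coalg_section_of_alg (IsWFStructure.coalg_factToRel_η hF.1 Y) hf
      (IsPullback.of_hasPullback f (R.ε₀ Y)).flip (R.η_ε₀ Y) (R.pathL_snd f) (R.pathL_fst f)) hf
    (𝟙 X) (pullback.snd f (R.ε₀ Y) ≫ R.ε₁ Y)
    (by rw [← Category.assoc, R.pathL_snd, Category.assoc, R.η_ε₁, Category.id_comp,
      Category.comp_id])
  exact ⟨d, h₁, h₂⟩

/-- Fibrancy of `X` allows the identity to be extended along `f`. -/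
theorem exists_retraction (hF : isTTWFS C F) {X Y : C} {f : X ⟶ Y} (hf : F.coalg f) :
    ∃ k : Y ⟶ X, f ≫ k = 𝟙 X := by
  obtain ⟨k, hk, -⟩ := Factn.exists_lift hf (hF.2.fibrant terminalIsTerminal (terminal.from X))
    (𝟙 X) (terminal.from Y) (terminal.hom_ext _ _)
  exact ⟨k, hk⟩

/-- One inclusion is `alg_le` with the classes of lifts reversed. For the other, a retraction `k` of
`f` exists by fibrancy, and `k ≫ f` agrees with the identity on `X`, so the two are homotopic
relative to `f`. Only the lifting half of a weak factorization system is used for `𝔐 Ξ F`, which is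
not yet known to be one. -/
theorem coalg_eq (hF : isTTWFS C F) :
    ((relToFact C).obj ((factToRel C).obj F)).coalg = F.coalg := by
  refine le_antisymm ?_ fun X Y f hf => ?_
  · rw [IsWFStructure.coalg_eq_llp hF.1]
    exact (Factn.coalg_le_llp _).trans (MorphismProperty.antitone_llp hF.alg_le)
  · obtain ⟨k, hk⟩ := hF.exists_retraction hf
    obtain ⟨H, h₁, h₂, h₃⟩ := Reln.exists_homotopy (IsWFStructure.alg_factToRel hF.1 Y)
      (F.coalg_le_llp _ hf) (a := k ≫ f) (b := 𝟙 Y) (by rw [reassoc_of% hk, Category.comp_id])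
    exact relToFact_coalg_iff.2 ⟨k, H, hk, by rw [h₁, Category.assoc, reassoc_of% hk], h₂, h₃⟩

theorem alg_eq (hF : isTTWFS C F) :
    ((relToFact C).obj ((factToRel C).obj F)).alg = F.alg := by
  refine le_antisymm ?_ hF.alg_le
  rw [IsWFStructure.alg_eq_rlp hF.1, ← hF.coalg_eq]
  exact Factn.alg_le_rlp _

/-- Left cancellation for the left class. -/
theorem coalg_of_comp (hF : isTTWFS C F) {X Y Z : C} {f : X ⟶ Y} {g : Y ⟶ Z}
    (hg : F.coalg g) (hfg : F.coalg (f ≫ g)) : F.coalg f := by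
  obtain ⟨m, hm⟩ := hF.exists_retraction hfg
  obtain ⟨n, hn⟩ := hF.exists_retraction hg
  rw [Category.assoc] at hm
  -- `K` is a homotopy on `Z` from `m ≫ f` to `n`; restricted along `g` it deforms `(g ≫ m) ≫ f`
  -- into the identity of `Y`.
  obtain ⟨K, h₁, h₂, h₃⟩ := Reln.exists_homotopy (IsWFStructure.alg_factToRel hF.1 Y)
    (F.coalg_le_llp _ hfg) (a := m ≫ f) (b := n)
    (by rw [Category.assoc, Category.assoc, reassoc_of% hm, hn, Category.comp_id])
  rw [← hF.coalg_eq]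
  refine relToFact_coalg_iff.2 ⟨g ≫ m, g ≫ K, hm, ?_, ?_, ?_⟩
  · rw [← Category.assoc, h₁, Category.assoc, Category.assoc, reassoc_of% hm]
  · rw [Category.assoc, h₂, Category.assoc]
  · rw [Category.assoc, h₃, hn]

/-- Sections in the left class of fibrations are stable under arbitrary base change. -/
theorem coalg_section (hF : isTTWFS C F) {A P W X : C} {e : W ⟶ X} {η : X ⟶ W}
    (he : F.alg e) (hη : F.coalg η) {α : A ⟶ X} {p : P ⟶ W} {q : P ⟶ A}
    (h : IsPullback p q e α) (hηe : η ≫ e = 𝟙 X) {s : A ⟶ P} (hp : s ≫ p = α ≫ η)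
    (hq : s ≫ q = 𝟙 A) : F.coalg s := by
  -- Base change along `α` is split into two stages by its factorization. Along the right factor
  -- `F.r α`, the section `s'` is already known to be a left map.
  let s' : F.Φ α ⟶ pullback e (F.r α) := pullback.lift (F.r α ≫ η) (𝟙 _) (by simp [hηe])
  have hs'₁ : s' ≫ pullback.fst _ _ = F.r α ≫ η := pullback.lift_fst _ _ _
  have hs'₂ : s' ≫ pullback.snd _ _ = 𝟙 _ := pullback.lift_snd _ _ _
  have hs' : F.coalg s' := hF.coalg_section_of_alg hη (hF.1 α).2
    (IsPullback.of_hasPullback e (F.r α)) hηe hs'₁ hs'₂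
  -- Here `g` is the base change of the left map `F.l α` along a pullback of `e`, hence a left map.
  -- Since `s ≫ g` equals `F.l α ≫ s'`, cancelling `g` shows that `s` is one too.
  let g : P ⟶ pullback e (F.r α) := pullback.lift p (q ≫ F.l α) (by simp [F.l_r, h.w])
  have hg₁ : g ≫ pullback.fst _ _ = p := pullback.lift_fst _ _ _
  have hg₂ : g ≫ pullback.snd _ _ = q ≫ F.l α := pullback.lift_snd _ _ _
  have sq : IsPullback g q (pullback.snd e (F.r α)) (F.l α) :=
    IsPullback.of_right (by rwa [hg₁, F.l_r]) hg₂ (IsPullback.of_hasPullback e (F.r α))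
  have hg : F.coalg g := hF.2.pullback_stable _ _ _ _ sq.flip (hF.1 α).1
    (IsWFStructure.alg_of_isPullback hF.1 (IsPullback.of_hasPullback e (F.r α)).flip he)
  refine hF.coalg_of_comp hg ?_
  have : s ≫ g = F.l α ≫ s' := by
    apply pullback.hom_ext
    · rw [Category.assoc, Category.assoc, hg₁, hs'₁, hp, ← Category.assoc, F.l_r]
    · rw [Category.assoc, Category.assoc, hg₂, hs'₂, reassoc_of% hq, Category.comp_id]
  rw [this]
  exact IsWFStructure.coalg_comp hF.1 (hF.1 α).1 hs'

theorem coalg_pathL (hF : isTTWFS C F) {X Y : C} (f : X ⟶ Y) :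
    F.coalg (((factToRel C).obj F).pathL f) :=
  hF.coalg_section (hF.alg_ε₀ Y) (IsWFStructure.coalg_factToRel_η hF.1 Y)
    (IsPullback.of_hasPullback f _).flip (Reln.η_ε₀ _ Y) (Reln.pathL_snd _ f) (Reln.pathL_fst _ f)

theorem alg_pathR (hF : isTTWFS C F) {X Y : C} (f : X ⟶ Y) :
    F.alg (pullback.snd f (((factToRel C).obj F).ε₀ Y) ≫ ((factToRel C).obj F).ε₁ Y) := by
  set R := (factToRel C).obj F
  -- The map `e` sends a point and a path to the point and the end of the path. It is the base
  -- change of `(ε₀, ε₁)` along `f × 1`, hence a right map, and the projection to `Y` is one by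
  -- fibrancy.
  let e : pullback f (R.ε₀ Y) ⟶ X ⨯ Y :=
    prod.lift (pullback.fst _ _) (pullback.snd _ _ ≫ R.ε₁ Y)
  have sq : IsPullback e (pullback.snd f (R.ε₀ Y)) (prod.map f (𝟙 Y))
      (prod.lift (R.ε₀ Y) (R.ε₁ Y)) := by
    refine ⟨⟨?_⟩, ⟨PullbackCone.IsLimit.mk _
      (fun c => pullback.lift (c.fst ≫ prod.fst) c.snd ?_) (fun c => ?_) (fun c => ?_) ?_⟩⟩
    · apply Limits.prod.hom_ext <;> simp [e, prod.lift_fst, prod.lift_snd, pullback.condition]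
    · simpa [prod.lift_fst, prod.lift_snd] using c.condition =≫ prod.fst
    · have := c.condition =≫ prod.snd
      apply Limits.prod.hom_ext
      · simp [e, prod.lift_fst, pullback.lift_fst]
      · simpa [e, prod.lift_snd, pullback.lift_snd_assoc] using this.symm
    · exact pullback.lift_snd _ _ _
    · intro c m h₁ h₂
      apply pullback.hom_ext
      · simp [← h₁, e, prod.lift_fst, pullback.lift_fst]
      · simp [h₂, pullback.lift_snd]
  have : pullback.snd f (R.ε₀ Y) ≫ R.ε₁ Y = e ≫ prod.snd := (prod.lift_snd _ _).symm
  rw [this]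
  exact IsWFStructure.alg_comp hF.1
    (IsWFStructure.alg_of_isPullback hF.1 sq (IsWFStructure.alg_factToRel hF.1 Y)) (hF.alg_snd X Y)

theorem isIdPresentation (hF : isTTWFS C F) : isIdPresentation C ((factToRel C).obj F) := by
  refine ⟨fun f => ?_, fun X => ⟨?_, fun A P α p q h s hp hq => ?_,
    fun A P α p q h s hp hq => ?_⟩⟩
  · rw [hF.coalg_eq, hF.alg_eq]
    exact ⟨hF.coalg_pathL f, hF.alg_pathR f⟩
  · rw [hF.alg_eq]
    exact IsWFStructure.alg_factToRel hF.1 X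
  · rw [hF.alg_eq, ← IsWFStructure.coalg_eq_llp hF.1]
    exact hF.coalg_section (hF.alg_ε₀ X) (IsWFStructure.coalg_factToRel_η hF.1 X) h
      (Reln.η_ε₀ _ X) hp hq
  · rw [hF.alg_eq, ← IsWFStructure.coalg_eq_llp hF.1]
    exact hF.coalg_section (hF.alg_ε₁ X) (IsWFStructure.coalg_factToRel_η hF.1 X) h
      (Reln.η_ε₁ _ X) hp hq

end isTTWFS

end Factorizations

/-! ### Comparison morphisms and the equivalence of truncations -/

section Comparison

open Factn

variable {C : Type u} [Category.{v} C]

/-- A factorization with left factors in `L` maps to one with right factors in `R`, if `L` lifts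
against `R`. -/
theorem Factn.nonempty_hom {F G : Factn C} {D : MorphismProperty C}
    (hF : ∀ {X Y : C} (f : X ⟶ Y), D.llp (F.l f)) (hG : ∀ {X Y : C} (f : X ⟶ Y), D (G.r f)) :
    Nonempty (F ⟶ G) := by
  have (X Y : C) (f : X ⟶ Y) := MorphismProperty.llp.exists_lift (hF f) (hG f) (G.l f) (F.r f)
    (by rw [F.l_r, G.l_r])
  choose d h₁ h₂ using this
  exact ⟨⟨fun {X Y} f => d X Y f, fun {X Y} f => h₁ X Y f, fun {X Y} f => h₂ X Y f⟩⟩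

/-- The component at `X` is a filler of the square from `R.η X` to `(ε₀, ε₁)` of `S`. Independent
choices suffice because naturality is not required. -/
theorem Reln.nonempty_hom [HasFiniteLimits C] {R S : Reln C} {D : MorphismProperty C}
    (hR : ∀ X : C, D.llp (R.η X)) (hS : ∀ X : C, D (prod.lift (S.ε₀ X) (S.ε₁ X))) :
    Nonempty (R ⟶ S) := by
  have (X : C) := MorphismProperty.llp.exists_lift (hR X) (hS X) (S.η X)
    (prod.lift (R.ε₀ X) (R.ε₁ X)) (by rw [R.η_lift, S.η_lift])
  choose d h₁ h₂ using this
  exact ⟨⟨d, h₁, fun X => by simpa [prod.lift_fst, prod.lift_snd] using h₂ X =≫ prod.fst,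
    fun X => by simpa [prod.lift_fst, prod.lift_snd] using h₂ X =≫ prod.snd⟩⟩

instance {P : Type*} [Category* P] [Quiver.IsThin P] (S : ObjectProperty P) :
    Quiver.IsThin S.FullSubcategory :=
  fun _ _ => ⟨fun _ _ => ObjectProperty.hom_ext _ (Subsingleton.elim _ _)⟩

/-- Functors between preorders which are mutually inverse up to the preorder form an
equivalence. -/
noncomputable def equivalenceOfLE {P : Type*} {Q : Type*} [Category* P] [Category* Q]
    [Quiver.IsThin P] [Quiver.IsThin Q] (M : P ⥤ Q) (N : Q ⥤ P)
    (h₁ : ∀ X, Nonempty (X ⟶ N.obj (M.obj X))) (h₂ : ∀ X, Nonempty (N.obj (M.obj X) ⟶ X))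
    (h₃ : ∀ X, Nonempty (X ⟶ M.obj (N.obj X))) (h₄ : ∀ X, Nonempty (M.obj (N.obj X) ⟶ X)) :
    P ≌ Q where
  functor := M
  inverse := N
  unitIso := NatIso.ofComponents
    (fun X => ⟨(h₁ X).some, (h₂ X).some, Subsingleton.elim _ _, Subsingleton.elim _ _⟩)
    fun _ => Subsingleton.elim _ _
  counitIso := NatIso.ofComponents
    (fun X => ⟨(h₄ X).some, (h₃ X).some, Subsingleton.elim _ _, Subsingleton.elim _ _⟩)
    fun _ => Subsingleton.elim _ _
  functor_unitIso_comp _ := Subsingleton.elim _ _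

variable [HasFiniteLimits C]

/-- `R` and `Ξ 𝔐 R` both factor the diagonal into a map lifting against the right class of `𝔐 R`
followed by a map in that class, so there are comparisons in both directions. -/
theorem isIdPresentation.nonempty_hom {R : Reln C} (hR : isIdPresentation C R) :
    Nonempty (R ⟶ (factToRel C).obj ((relToFact C).obj R)) :=
  Reln.nonempty_hom (fun X => (hR.2 X).llp_η) fun X => IsWFStructure.alg_factToRel hR.1 X

theorem isIdPresentation.nonempty_hom' {R : Reln C} (hR : isIdPresentation C R) :
    Nonempty ((factToRel C).obj ((relToFact C).obj R) ⟶ R) :=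
  Reln.nonempty_hom (fun X => Factn.coalg_le_llp _ _ (IsWFStructure.coalg_factToRel_η hR.1 X))
    fun X => (hR.2 X).display

theorem isTTWFS.nonempty_hom {F : Factn C} (hF : isTTWFS C F) :
    Nonempty (F ⟶ (relToFact C).obj ((factToRel C).obj F)) :=
  Factn.nonempty_hom (fun f => F.coalg_le_llp _ (hF.1 f).1) fun f => hF.alg_pathR f

theorem isTTWFS.nonempty_hom' {F : Factn C} (hF : isTTWFS C F) :
    Nonempty ((relToFact C).obj ((factToRel C).obj F) ⟶ F) :=
  Factn.nonempty_hom (fun f => F.coalg_le_llp _ (hF.coalg_pathL f)) fun f => (hF.1 f).2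

variable (C)

/-- The restriction of `𝔐` to `Id`-presentations. -/
noncomputable def idPresToTTWFS : IdPres C ⥤ TTWFS C :=
  (isTTWFS C).lift (ObjectProperty.ι _ ⋙ relToFact C) fun R => R.property.isTTWFS

/-- The restriction of `Ξ` to type-theoretic weak factorization structures. -/
noncomputable def ttwfsToIdPres : TTWFS C ⥤ IdPres C :=
  (isIdPresentation C).lift (ObjectProperty.ι _ ⋙ factToRel C) fun F => F.property.isIdPresentation

/-- The restriction of `𝔐` to functorial `Id`-presentations. -/
noncomputable def fidPresToFTTWFS : FIdPres C ⥤ FTTWFS C :=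
  ObjectProperty.lift _ (ObjectProperty.ι _ ⋙ frelToFact C) fun R =>
    isIdPresentation.isTTWFS R.property

/-- The restriction of `Ξ` to functorial type-theoretic weak factorization structures. -/
noncomputable def fttwfsToFIdPres : FTTWFS C ⥤ FIdPres C :=
  ObjectProperty.lift _ (ObjectProperty.ι _ ⋙ ffactToRel C) fun F =>
    isTTWFS.isIdPresentation F.property

/-- The truncations of `𝔐` and `Ξ` form an equivalence. -/
noncomputable def prosetEquivalence : Proset (IdPres C) ≌ Proset (TTWFS C) :=
  equivalenceOfLE (Proset.map (idPresToTTWFS C)) (Proset.map (ttwfsToIdPres C))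
    (fun R => ⟨homOfLE (R.obj.property.nonempty_hom.map fun a => ObjectProperty.homMk a)⟩)
    (fun R => ⟨homOfLE (R.obj.property.nonempty_hom'.map fun a => ObjectProperty.homMk a)⟩)
    (fun F => ⟨homOfLE (F.obj.property.nonempty_hom.map fun a => ObjectProperty.homMk a)⟩)
    (fun F => ⟨homOfLE (F.obj.property.nonempty_hom'.map fun a => ObjectProperty.homMk a)⟩)

/-- The restriction of `prosetEquivalence` to the functorial objects. -/
noncomputable def prosetFunctorialEquivalence : ProsetIdPresFunctorial C ≌ ProsetTTWFSFunctorial C :=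
  equivalenceOfLE
    ((isFunctorialTTWFS C).lift (ObjectProperty.ι _ ⋙ (prosetEquivalence C).functor)
      -- A functorial lift of the image is given by the functorial version of `𝔐`, because the
      -- square with the inclusions commutes strictly on objects.
      fun ⟨_, S, hS⟩ => ⟨(fidPresToFTTWFS C).obj S, congrArg (idPresToTTWFS C).obj hS⟩)
    ((isFunctorialIdPres C).lift (ObjectProperty.ι _ ⋙ (prosetEquivalence C).inverse)
      fun ⟨_, S, hS⟩ => ⟨(fttwfsToFIdPres C).obj S, congrArg (ttwfsToIdPres C).obj hS⟩)
    (fun R => ⟨ObjectProperty.homMk ((prosetEquivalence C).unit.app R.obj)⟩)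
    (fun R => ⟨ObjectProperty.homMk ((prosetEquivalence C).unitInv.app R.obj)⟩)
    (fun F => ⟨ObjectProperty.homMk ((prosetEquivalence C).counitInv.app F.obj)⟩)
    (fun F => ⟨ObjectProperty.homMk ((prosetEquivalence C).counit.app F.obj)⟩)

end Comparison

theorem theorem6p1 (C : Type u) [Category.{v} C] [HasFiniteLimits C] :
    ∃ (M : IdPres C ⥤ TTWFS C) (Ξ : TTWFS C ⥤ IdPres C)
      (fM : FIdPres C ⥤ FTTWFS C) (fΞ : FTTWFS C ⥤ FIdPres C),
      -- the functors are the restrictions of the four given functors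
      (M ⋙ ObjectProperty.ι _ = ObjectProperty.ι _ ⋙ relToFact C ∧
        Ξ ⋙ ObjectProperty.ι _ = ObjectProperty.ι _ ⋙ factToRel C ∧
        fM ⋙ ObjectProperty.ι _ = ObjectProperty.ι _ ⋙ frelToFact C ∧
        fΞ ⋙ ObjectProperty.ι _ = ObjectProperty.ι _ ⋙ ffactToRel C) ∧
      -- both squares with the inclusions of the functorial versions commute
      (fM ⋙ FTTWFS.incl C = FIdPres.incl C ⋙ M ∧
        fΞ ⋙ FIdPres.incl C = FTTWFS.incl C ⋙ Ξ) ∧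
      -- the truncated functors constitute an equivalence
      ∃ e : Proset (IdPres C) ≌ Proset (TTWFS C),
        e.functor = Proset.map M ∧ e.inverse = Proset.map Ξ ∧
        -- which restricts to an equivalence between the functorial parts
        ∃ f : ProsetIdPresFunctorial C ≌ ProsetTTWFSFunctorial C,
          (f.functor ⋙ ObjectProperty.ι _ = ObjectProperty.ι _ ⋙ e.functor ∧
            f.inverse ⋙ ObjectProperty.ι _ = ObjectProperty.ι _ ⋙ e.inverse) ∧
          (toProsetIdPresFunctorial C ⋙ f.functor =
              Proset.map fM ⋙ toProsetTTWFSFunctorial C ∧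
            toProsetTTWFSFunctorial C ⋙ f.inverse =
              Proset.map fΞ ⋙ toProsetIdPresFunctorial C) := by
  exact ⟨idPresToTTWFS C, ttwfsToIdPres C, fidPresToFTTWFS C, fttwfsToFIdPres C,
    ⟨rfl, rfl, rfl, rfl⟩, ⟨rfl, rfl⟩, prosetEquivalence C, rfl, rfl,
    prosetFunctorialEquivalence C, ⟨rfl, rfl⟩, rfl, rfl⟩
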